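/- Let $K$ be a field, $S=K[x_1,\dots,x_n]$, and $\mathfrak m=(x_1,\dots,x_n)$. Let $I\subset S$ be a nonzero monomial ideal generated in a single degree, and let $G(I)=\{u_1,\dots,u_m\}$ be its minimal set of monomial generators. Assume that $I$ has linear relations, i.e. that the kernel of the $S$-linear map $\bigoplus_{k=1}^m Se_k\to I$, $e_k\mapsto u_k$, is generated by elements $\sum_k \ell_k e_k$ all of whose coefficients $\ell_k$ are linear forms (possibly zero). Let $\Gamma$ be the linear relation graph of $I$: its edges are the sets $\{i,j\}$ with $i\neq j$ for which there exist $u_k,u_l\in G(I)$ with $x_iu_k=x_ju_l$, and its vertices are the endpoints of its edges. If $\Gamma$ has $r$ vertices and $s$ connected components, then the analytic spread of $I$, that is, the Krull dimension $\ell(I)$ of the fiber ring $\mathcal R(I)/\mathfrak m\mathcal R(I)$, where $\mathcal R(I)=\bigoplus_{k\ge 0}I^kt^k\subset S[t]$ is the Rees algebra of $I$, is $$\ell(I)=r-s+1.$$ -/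

import Mathlib

noncomputable section

/-- A monomial ideal of `K[σ]`: an ideal generated by a set of monomials. -/
def IsMonomialIdeal {K σ : Type*} [Field K] (I : Ideal (MvPolynomial σ K)) : Prop :=
  ∃ A : Set (σ →₀ ℕ), I = Ideal.span ((fun a => MvPolynomial.monomial a (1 : K)) '' A)

/-- The exponent vectors of the minimal monomial generators `G(I)` of a monomial ideal `I`:
those of the monomials in `I` that are minimal with respect to divisibility. -/
def minGens {K σ : Type*} [Field K] (I : Ideal (MvPolynomial σ K)) : Set (σ →₀ ℕ) :=
  {a | Minimal (fun b => MvPolynomial.monomial b (1 : K) ∈ I) a}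

/-- A monomial ideal is generated in a single degree if all elements of `G(I)` have the same
total degree. -/
def IsEquigenerated {K σ : Type*} [Field K] (I : Ideal (MvPolynomial σ K)) : Prop :=
  ∃ d : ℕ, ∀ a ∈ minGens I, a.degree = d

/-- The module of relations (first syzygies) of the minimal monomial generators of `I`: the kernel
of the map from the free module on `G(I)` that sends the basis element `e_u` to `u`. -/
def relationModule {K σ : Type*} [Field K] (I : Ideal (MvPolynomial σ K)) :
    Submodule (MvPolynomial σ K) (minGens I →₀ MvPolynomial σ K) :=
  LinearMap.ker (Finsupp.linearCombination (MvPolynomial σ K)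
    (fun a : minGens I => MvPolynomial.monomial a.1 (1 : K)))

/-- `I` has linear relations: its module of relations is generated by relations all of whose
coefficients are linear forms (possibly zero). -/
def HasLinearRelations {K σ : Type*} [Field K] (I : Ideal (MvPolynomial σ K)) : Prop :=
  Submodule.span (MvPolynomial σ K)
    {f | f ∈ relationModule I ∧ ∀ a, (f a).IsHomogeneous 1} = relationModule I

/-- The graph on all variables whose edges are the edges of the linear relation graph:
`{i, j}` with `i ≠ j` and `x_i u = x_j v` for some `u, v ∈ G(I)`. -/
def linearRelationGraphOnVars {K σ : Type*} [Field K] (I : Ideal (MvPolynomial σ K)) :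
    SimpleGraph σ where
  Adj i j := i ≠ j ∧ ∃ a ∈ minGens I, ∃ b ∈ minGens I,
    MvPolynomial.X i * MvPolynomial.monomial a (1 : K)
      = MvPolynomial.X j * MvPolynomial.monomial b (1 : K)
  symm := ⟨by
    rintro i j ⟨hij, a, ha, b, hb, h⟩
    exact ⟨hij.symm, b, hb, a, ha, h.symm⟩⟩
  loopless := ⟨fun _ h => h.1 rfl⟩

/-- The vertices of the linear relation graph: the endpoints of its edges. -/
abbrev linearRelationVertices {K σ : Type*} [Field K] (I : Ideal (MvPolynomial σ K)) : Set σ :=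
  (linearRelationGraphOnVars I).support

/-- The linear relation graph of `I`. -/
def linearRelationGraph {K σ : Type*} [Field K] (I : Ideal (MvPolynomial σ K)) :
    SimpleGraph (linearRelationVertices I) :=
  (linearRelationGraphOnVars I).induce (linearRelationVertices I)

/-- The graded maximal ideal of the polynomial ring `K[σ]`, generated by the variables. -/
def gradedMaximalIdeal (K σ : Type*) [Field K] : Ideal (MvPolynomial σ K) :=
  Ideal.span (Set.range MvPolynomial.X)

/-- The fiber ring `R(I) / m R(I)`, where `R(I)` is the Rees algebra of `I`. -/
abbrev FiberRing {K σ : Type*} [Field K] (I : Ideal (MvPolynomial σ K)) : Type _ :=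
  reesAlgebra I ⧸ (gradedMaximalIdeal K σ).map (algebraMap (MvPolynomial σ K) (reesAlgebra I))

/-- The analytic spread of `I`: the Krull dimension of the fiber ring. -/
def analyticSpread {K σ : Type*} [Field K] (I : Ideal (MvPolynomial σ K)) : WithBot ℕ∞ :=
  ringKrullDim (FiberRing I)

end

/-! Let the generators have degree `d`. The `t^k`-coefficient of a polynomial in the elements `u t`
is homogeneous of degree `dk`, while that of an element of `𝔪R(I)` lies in `𝔪^(dk+1)`. Hence the
fiber ring is the monomial algebra `K[u t : u ∈ G(I)]` (`toFiberRing_surjective`,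
`ker_toFiberRing`), and its dimension is the rank of the exponent vectors `(a, 1)`
(`ringKrullDim_range_aeval_monomial`).

Linear relations make any two generators joined by a chain of relations `x_i u = x_j v`
(`reflTransGen_linearlyLinked`). Along such a chain the exponent changes by edge vectors `e_i - e_j`
of the graph, so the rank is 1 for a starting generator plus the rank of the edge vectors. The
latter is `r - s`, since the edge vectors span the kernel of summation over components
(`SimpleGraph.edgeSpan_eq_ker`). -/

/-! ### Krull dimension and transcendence bases -/

/-- Lying over and going up lift chains of primes; incomparability keeps contracted chains strict.
-/
theorem ringKrullDim_eq_of_injective_isIntegral {R S : Type*} [CommRing R] [CommRing S]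
    (f : R →+* S) (hf : Function.Injective f) (hint : f.IsIntegral) :
    ringKrullDim R = ringKrullDim S := by
  let _ : Algebra R S := f.toAlgebra
  have : Algebra.IsIntegral R S := ⟨hint⟩
  refine le_antisymm ?_ ?_
  · refine iSup_le fun l => ?_
    obtain ⟨P, hP, hPl⟩ := Ideal.exists_ideal_over_prime_of_isIntegral (S := S) l.head.asIdeal ⊥
      (by
        have : Ideal.comap (algebraMap R S) ⊥ = ⊥ := by
          rw [← RingHom.ker_eq_comap_bot]
          exact (RingHom.injective_iff_ker_eq_bot _).1 hf
        rw [this]; exact bot_le)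
    have hP' := hPl.1
    have : P.LiesOver l.head.asIdeal := ⟨hPl.2.symm⟩
    obtain ⟨L, hL, -⟩ := Ideal.exists_ltSeries_of_hasGoingUp l P
    rw [← hL]
    exact Order.LTSeries.length_le_krullDim L
  · refine Order.krullDim_le_of_strictMono (PrimeSpectrum.comap (algebraMap R S)) ?_
    intro p q hpq
    exact Ideal.IsIntegral.comap_lt_comap (R := R) (I := p.asIdeal) (J := q.asIdeal) hpq

/-- Noether normalization makes `A` integral over a polynomial ring whose variables form another
transcendence basis of `A`, hence one of the same cardinality. -/
theorem ringKrullDim_eq_natCard_of_isTranscendenceBasis {K A ι : Type*} [Field K] [CommRing A]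
    [IsDomain A] [Algebra K A] [Algebra.FiniteType K A] {x : ι → A}
    (hx : IsTranscendenceBasis K x) : ringKrullDim A = Nat.card ι := by
  obtain ⟨s, g, hg, hint⟩ := exists_integral_inj_algHom_of_fg K A
  rw [← ringKrullDim_eq_of_injective_isIntegral g.toRingHom hg hint,
    MvPolynomial.ringKrullDim_of_isNoetherianRing, ringKrullDim_eq_zero_of_field, zero_add]
  let _ : Algebra (MvPolynomial (Fin s) K) A := g.toRingHom.toAlgebra
  have : IsScalarTower K (MvPolynomial (Fin s) K) A :=
    IsScalarTower.of_algebraMap_eq fun r => (g.commutes r).symm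
  have : FaithfulSMul (MvPolynomial (Fin s) K) A :=
    (faithfulSMul_iff_algebraMap_injective _ _).2 hg
  have : Algebra.IsIntegral (MvPolynomial (Fin s) K) A := ⟨hint⟩
  have hb := (IsTranscendenceBasis.mvPolynomial (Fin s) K).algebraMap_comp (A := A)
  have h := congrArg Cardinal.toNat (hx.lift_cardinalMk_eq hb)
  simp only [Cardinal.toNat_lift] at h
  simp only [Nat.card]
  rw [h]

/-! ### Dimension of monomial algebras -/

theorem aeval_monomial_eq_sum {K ι τ : Type*} [Field K] (v : ι → τ →₀ ℕ) (p : MvPolynomial ι K) :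
    MvPolynomial.aeval (fun i => MvPolynomial.monomial (v i) (1 : K)) p =
      ∑ s ∈ p.support,
        MvPolynomial.monomial (Finsupp.linearCombination ℕ v s) (MvPolynomial.coeff s p) := by
  conv_lhs => rw [p.as_sum, map_sum]
  refine Finset.sum_congr rfl fun s _ => ?_
  rw [MvPolynomial.aeval_monomial, Finsupp.prod, Finsupp.linearCombination_apply, Finsupp.sum]
  simp only [MvPolynomial.monomial_pow, one_pow]
  rw [← MvPolynomial.monomial_sum_one, MvPolynomial.algebraMap_eq, MvPolynomial.C_mul_monomial,
    mul_one]

/-- Independence over `ℕ` sends distinct monomials to distinct monomials, so no terms can cancel. -/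
theorem algebraicIndependent_monomial {K ι τ : Type*} [Field K] {v : ι → τ →₀ ℕ}
    (hv : LinearIndependent ℕ v) :
    AlgebraicIndependent K (fun i => MvPolynomial.monomial (v i) (1 : K)) := by
  classical
  rw [algebraicIndependent_iff]
  intro p hp
  ext s
  have h := congrArg (MvPolynomial.coeff (Finsupp.linearCombination ℕ v s)) hp
  rw [aeval_monomial_eq_sum, MvPolynomial.coeff_sum] at h
  simp only [MvPolynomial.coeff_monomial] at h
  have hinj : ∀ t, Finsupp.linearCombination ℕ v t = Finsupp.linearCombination ℕ v s ↔ t = s :=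
    fun t => ⟨fun h => hv h, fun h => by rw [h]⟩
  simp only [hinj, Finset.sum_ite_eq', MvPolynomial.coeff_zero] at h
  by_cases hs : s ∈ p.support
  · simpa [hs] using h
  · simpa using hs

/-- The rational vector attached to an exponent vector. -/
noncomputable def ratExponent (τ : Type*) : (τ →₀ ℕ) →+ (τ →₀ ℚ) :=
  Finsupp.mapRange.addMonoidHom (Nat.castAddMonoidHom ℚ)

theorem ratExponent_apply {τ : Type*} (a : τ →₀ ℕ) (i : τ) : ratExponent τ a i = a i := rfl

theorem ratExponent_injective (τ : Type*) : Function.Injective (ratExponent τ) :=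
  Finsupp.mapRange_injective _ (Nat.cast_zero) Nat.cast_injective

theorem ratExponent_linearCombination {ι τ : Type*} (v : ι → τ →₀ ℕ) (f : ι →₀ ℕ) :
    ratExponent τ (Finsupp.linearCombination ℕ v f) =
      Finsupp.linearCombination ℚ (fun i => ratExponent τ (v i)) (ratExponent ι f) := by
  induction f using Finsupp.induction_linear with
  | zero => simp
  | add f g hf hg => simp only [map_add, hf, hg]
  | single i n =>
    have : ratExponent ι (Finsupp.single i n) = Finsupp.single i (n : ℚ) :=
      Finsupp.mapRange_single (hf := Nat.cast_zero) ..
    rw [this, Finsupp.linearCombination_single, Finsupp.linearCombination_single, map_nsmul,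
      Nat.cast_smul_eq_nsmul]

/-- Clear denominators, then move the negative coefficients to the other side. -/
theorem exists_linearCombination_of_mem_span {ι τ : Type*} {v : ι → τ →₀ ℕ} {w : τ →₀ ℕ}
    (hw : ratExponent τ w ∈ Submodule.span ℚ (Set.range fun i => ratExponent τ (v i))) :
    ∃ N : ℕ, N ≠ 0 ∧ ∃ f g : ι →₀ ℕ,
      N • w + Finsupp.linearCombination ℕ v f = Finsupp.linearCombination ℕ v g := by
  rw [Finsupp.mem_span_range_iff_exists_finsupp] at hw
  obtain ⟨c, hc⟩ := hw
  obtain ⟨⟨b, hb⟩, hbc⟩ := IsLocalization.exist_integer_multiples (nonZeroDivisors ℤ) c.support c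
  have hb0 : b ≠ 0 := nonZeroDivisors.ne_zero hb
  have hint : ∀ i, ∃ z : ℤ, (z : ℚ) = b * c i := by
    intro i
    by_cases hi : i ∈ c.support
    · obtain ⟨z, hz⟩ := hbc i hi
      exact ⟨z, by simpa [Submonoid.smul_def] using hz⟩
    · exact ⟨0, by simp [Finsupp.notMem_support_iff.1 hi]⟩
  choose z hz using hint
  have hz0 : ∀ i, z i ≠ 0 → i ∈ c.support := fun i hi => by
    rw [Finsupp.mem_support_iff]
    intro h
    have := hz i
    rw [h, mul_zero] at this
    exact hi (by exact_mod_cast this)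
  let f : ι →₀ ℕ := Finsupp.onFinset c.support (fun i => (-(b * z i)).toNat)
    (fun i hi => hz0 i fun h => hi (by simp [h]))
  let g : ι →₀ ℕ := Finsupp.onFinset c.support (fun i => (b * z i).toNat)
    (fun i hi => hz0 i fun h => hi (by simp [h]))
  -- The common denominator `b` may be negative; multiplying by `b ^ 2` instead gives a natural
  -- multiplier, with integer coefficients `b * z i`.
  refine ⟨b.natAbs ^ 2, by simpa using hb0, f, g, ratExponent_injective τ ?_⟩
  have hw : ratExponent τ w = Finsupp.linearCombination ℚ (fun i => ratExponent τ (v i)) c := by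
    rw [← hc, Finsupp.linearCombination_apply]
  rw [map_add, map_nsmul, ratExponent_linearCombination, ratExponent_linearCombination, hw,
    ← map_nsmul, ← map_add]
  congr 1
  ext i
  have h1 : ratExponent ι f i = ((-(b * z i)).toNat : ℕ) := rfl
  have h2 : ratExponent ι g i = ((b * z i).toNat : ℕ) := rfl
  rw [Finsupp.add_apply, Finsupp.smul_apply, h1, h2]
  have h3 : (((b * z i).toNat : ℤ) : ℚ) - (((-(b * z i)).toNat : ℤ) : ℚ) = b * z i := by
    rw [← Int.cast_sub, Int.toNat_sub_toNat_neg, Int.cast_mul]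
  have h4 : ((b.natAbs ^ 2 : ℕ) : ℚ) = (b : ℚ) ^ 2 := by
    have : ((b.natAbs ^ 2 : ℕ) : ℤ) = b ^ 2 := by simp
    rw [← Int.cast_natCast (R := ℚ), this, Int.cast_pow]
  rw [nsmul_eq_mul, h4]
  simp only [Int.cast_natCast] at h3
  have := hz i
  linear_combination (-1 : ℚ) * h3 - b * this

theorem linearIndependent_nat_of_ratExponent {ι τ : Type*} {v : ι → τ →₀ ℕ}
    (hv : LinearIndependent ℚ fun i => ratExponent τ (v i)) : LinearIndependent ℕ v := by
  intro f g hfg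
  apply ratExponent_injective ι
  apply hv
  rw [← ratExponent_linearCombination, ← ratExponent_linearCombination, hfg]

theorem Subalgebra.isAlgebraic_of_mul_pow_eq {K A : Type*} [Field K] [CommRing A] [Algebra K A]
    (R : Subalgebra K A) {y p q : A} (hp : p ∈ R) (hq : q ∈ R) (hp0 : p ≠ 0) {N : ℕ} (hN : N ≠ 0)
    (h : p * y ^ N = q) : IsAlgebraic R y := by
  refine ⟨Polynomial.C ⟨p, hp⟩ * Polynomial.X ^ N - Polynomial.C ⟨q, hq⟩, ?_, ?_⟩
  · intro h
    have h' := congrArg (fun p => Polynomial.coeff p N) h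
    simp only [Polynomial.coeff_sub, Polynomial.coeff_C_mul, Polynomial.coeff_X_pow, if_true,
      mul_one, Polynomial.coeff_C, hN, if_false, sub_zero, Polynomial.coeff_zero] at h'
    exact hp0 (congrArg Subtype.val h')
  · simp only [map_sub, map_mul, Polynomial.aeval_C, map_pow, Polynomial.aeval_X]
    rw [sub_eq_zero]
    exact h

theorem Subalgebra.isAlgebraic_of_adjoin_eq_top {K A : Type*} [Field K] [CommRing A] [IsDomain A]
    [Algebra K A] (R : Subalgebra K A) {s : Set A} (hs : Algebra.adjoin K s = ⊤)
    (h : ∀ y ∈ s, IsAlgebraic R y) : Algebra.IsAlgebraic R A := by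
  have hle : (⊤ : Subalgebra K A) ≤ (Subalgebra.algebraicClosure R A).restrictScalars K := by
    rw [← hs]
    exact Algebra.adjoin_le h
  exact ⟨fun z => hle (Algebra.mem_top (x := z))⟩

/-- The dimension of a monomial algebra is the rank of its exponent vectors. -/
theorem ringKrullDim_range_aeval_monomial (K : Type*) {ι τ : Type*} [Field K] [Finite ι]
    (v : ι → τ →₀ ℕ) :
    ringKrullDim
      (MvPolynomial.aeval (R := K) fun i => MvPolynomial.monomial (v i) (1 : K)).range =
      Module.finrank ℚ (Submodule.span ℚ (Set.range fun i => ratExponent τ (v i))) := by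
  set φ := MvPolynomial.aeval (R := K) fun i => MvPolynomial.monomial (v i) (1 : K) with hφ
  obtain ⟨κ, a, ha, hspan, hli⟩ := exists_linearIndependent' ℚ fun i => ratExponent τ (v i)
  have : Finite κ := Finite.of_injective a ha
  have : Fintype κ := Fintype.ofFinite κ
  rw [← hspan, finrank_span_eq_card hli, ← Nat.card_eq_fintype_card]
  have : Algebra.FiniteType K φ.range :=
    Algebra.FiniteType.of_surjective φ.rangeRestrict φ.rangeRestrict_surjective
  let y : ι → φ.range := fun i => φ.rangeRestrict (MvPolynomial.X i)
  have hy : ∀ i, (y i : MvPolynomial τ K) = MvPolynomial.monomial (v i) 1 := fun i => by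
    simp [y, hφ]
  refine ringKrullDim_eq_natCard_of_isTranscendenceBasis (K := K) (x := y ∘ a) ?_
  have hind : AlgebraicIndependent K (y ∘ a) := by
    refine AlgebraicIndependent.of_comp φ.range.val ?_
    have := algebraicIndependent_monomial (K := K) (linearIndependent_nat_of_ratExponent
      (v := v ∘ a) hli)
    convert this using 1
    exact funext fun k => hy (a k)
  rw [hind.isTranscendenceBasis_iff_isAlgebraic]
  set R := Algebra.adjoin K (Set.range (y ∘ a)) with hR
  have hmem : ∀ f : κ →₀ ℕ, (f.prod fun k n => (y ∘ a) k ^ n) ∈ R := fun f =>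
    R.prod_mem fun k _ => R.pow_mem (Algebra.subset_adjoin ⟨k, rfl⟩) _
  have hprod' : ∀ f : κ →₀ ℕ, ((f.prod fun k n => (y ∘ a) k ^ n : φ.range) : MvPolynomial τ K) =
      MvPolynomial.monomial (Finsupp.linearCombination ℕ (v ∘ a) f) 1 := by
    intro f
    rw [Finsupp.linearCombination_apply, Finsupp.sum, MvPolynomial.monomial_sum_one, Finsupp.prod]
    simp [hy, MvPolynomial.monomial_pow]
  have halg : ∀ i, IsAlgebraic R (y i) := by
    intro i
    obtain ⟨N, hN, f, g, hfg⟩ := exists_linearCombination_of_mem_span (v := v ∘ a) (w := v i) (by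
      have : ratExponent τ (v i) ∈ Submodule.span ℚ (Set.range fun i => ratExponent τ (v i)) :=
        Submodule.subset_span ⟨i, rfl⟩
      rwa [← hspan] at this)
    refine R.isAlgebraic_of_mul_pow_eq (hmem f) (hmem g) (fun h => ?_) hN ?_
    · have h' := congrArg (Subtype.val : φ.range → MvPolynomial τ K) h
      rw [hprod'] at h'
      exact one_ne_zero (MvPolynomial.monomial_eq_zero.1 h')
    · apply Subtype.ext
      rw [MulMemClass.coe_mul, SubmonoidClass.coe_pow, hprod', hprod', hy,
        MvPolynomial.monomial_pow, one_pow, MvPolynomial.monomial_mul, one_mul, ← hfg, add_comm]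
  refine R.isAlgebraic_of_adjoin_eq_top (s := Set.range y) ?_ (by rintro _ ⟨i, rfl⟩; exact halg i)
  have : Set.range y = φ.rangeRestrict '' Set.range MvPolynomial.X := by
    rw [← Set.range_comp]; rfl
  rw [this, ← AlgHom.map_adjoin, MvPolynomial.adjoin_range_X, Algebra.map_top,
    AlgHom.range_eq_top]
  exact φ.rangeRestrict_surjective

/-! ### Edge vectors of a graph -/

/-- The span of the rational edge vectors `e_i - e_j` of a graph. -/
noncomputable def SimpleGraph.edgeSpan {V : Type*} (G : SimpleGraph V) : Submodule ℚ (V →₀ ℚ) :=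
  Submodule.span ℚ {x | ∃ i j, G.Adj i j ∧ x = Finsupp.single i 1 - Finsupp.single j 1}

theorem SimpleGraph.Reachable.single_sub_single_mem_edgeSpan {V : Type*} {G : SimpleGraph V}
    {i j : V} (h : G.Reachable i j) :
    Finsupp.single i (1 : ℚ) - Finsupp.single j 1 ∈ G.edgeSpan := by
  obtain ⟨w⟩ := h
  induction w with
  | nil => simp
  | cons hadj _ ih =>
    rw [← sub_add_sub_cancel]
    exact add_mem (Submodule.subset_span ⟨_, _, hadj, rfl⟩) ih

theorem SimpleGraph.edgeSpan_eq_ker {V : Type*} (G : SimpleGraph V) :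
    G.edgeSpan = LinearMap.ker (Finsupp.lmapDomain ℚ ℚ G.connectedComponentMk) := by
  refine le_antisymm ?_ fun f hf => ?_
  · rw [edgeSpan, Submodule.span_le]
    rintro _ ⟨i, j, hij, rfl⟩
    have : G.connectedComponentMk i = G.connectedComponentMk j :=
      SimpleGraph.ConnectedComponent.eq.2 hij.reachable
    rw [SetLike.mem_coe, LinearMap.mem_ker, map_sub]
    simp [this]
  · choose rep hrep using fun c : G.ConnectedComponent => c.exists_rep
    -- Moving all mass to component representatives changes `f` by edge vectors only; if every
    -- component sum vanishes, nothing remains.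
    have key : ∀ f : V →₀ ℚ, f - Finsupp.mapDomain (rep ∘ G.connectedComponentMk) f ∈
        G.edgeSpan := by
      intro f
      induction f using Finsupp.induction_linear with
      | zero => simp
      | add f g hf hg =>
        rw [Finsupp.mapDomain_add, add_sub_add_comm]
        exact add_mem hf hg
      | single i c =>
        rw [Finsupp.mapDomain_single]
        have h : G.Reachable i ((rep ∘ G.connectedComponentMk) i) :=
          SimpleGraph.ConnectedComponent.exact (hrep _).symm
        have := Submodule.smul_mem _ c h.single_sub_single_mem_edgeSpan
        simpa [smul_sub] using this
    have h := key f
    have hf' : Finsupp.mapDomain G.connectedComponentMk f = 0 := hf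
    rwa [Finsupp.mapDomain_comp, hf', Finsupp.mapDomain_zero, sub_zero] at h

theorem SimpleGraph.finrank_edgeSpan_add_card {V : Type*} [Finite V] (G : SimpleGraph V) :
    Module.finrank ℚ G.edgeSpan + Nat.card G.ConnectedComponent = Nat.card V := by
  have : Fintype V := Fintype.ofFinite V
  have : Fintype G.ConnectedComponent := Fintype.ofFinite _
  have h := LinearMap.finrank_range_add_finrank_ker (Finsupp.lmapDomain ℚ ℚ G.connectedComponentMk)
  rw [LinearMap.range_eq_top.2 (Finsupp.mapDomain_surjective Quot.mk_surjective), finrank_top,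
    Module.finrank_finsupp_self, Module.finrank_finsupp_self, ← G.edgeSpan_eq_ker] at h
  rw [Nat.card_eq_fintype_card, Nat.card_eq_fintype_card, add_comm, h]

theorem SimpleGraph.map_edgeSpan_induce_support {V : Type*} (G : SimpleGraph V) :
    (G.induce G.support).edgeSpan.map (Finsupp.lmapDomain ℚ ℚ Subtype.val) = G.edgeSpan := by
  rw [edgeSpan, edgeSpan, Submodule.map_span]
  congr 1
  ext x
  constructor
  · rintro ⟨_, ⟨i, j, hij, rfl⟩, rfl⟩
    exact ⟨i, j, hij, by rw [map_sub]; simp⟩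
  · rintro ⟨i, j, hij, rfl⟩
    exact ⟨_, ⟨⟨i, j, hij⟩, ⟨j, i, hij.symm⟩, hij, rfl⟩, by rw [map_sub]; simp⟩

theorem SimpleGraph.finrank_edgeSpan_induce_support {V : Type*} (G : SimpleGraph V) :
    Module.finrank ℚ (G.induce G.support).edgeSpan = Module.finrank ℚ G.edgeSpan := by
  rw [← G.map_edgeSpan_induce_support]
  exact (LinearEquiv.finrank_eq (Submodule.equivMapOfInjective _
    (Finsupp.mapDomain_injective Subtype.val_injective) _))

/-! ### Linear relations connect the generators -/

theorem linearRelationGraphOnVars_adj_iff {K σ : Type*} [Field K]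
    {I : Ideal (MvPolynomial σ K)} {i j : σ} : (linearRelationGraphOnVars I).Adj i j ↔ i ≠ j ∧
      ∃ a ∈ minGens I, ∃ b ∈ minGens I, Finsupp.single i 1 + a = Finsupp.single j 1 + b := by
  simp only [linearRelationGraphOnVars, MvPolynomial.X, MvPolynomial.monomial_mul, mul_one]
  simp only [MvPolynomial.monomial_left_inj (one_ne_zero (α := K))]

/-- Two minimal generators are linked if they satisfy a linear binomial relation. -/
def LinearlyLinked {K σ : Type*} [Field K] (I : Ideal (MvPolynomial σ K)) (a b : minGens I) :
    Prop :=
  ∃ i j, Finsupp.single i 1 + a.1 = Finsupp.single j 1 + b.1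

/-- The generators contributing to the coefficient of a monomial `m` all satisfy `m = x_i u`, so
they are pairwise linked: if one lies in `C`, all do. Each coefficient of the truncated sum is thus
either the full one, which is zero, or empty. -/
theorem linearCombination_indicator_eq_zero {K σ : Type*} [Field K]
    {I : Ideal (MvPolynomial σ K)} (C : Set (minGens I)) [DecidablePred (· ∈ C)]
    (hC : ∀ a b, LinearlyLinked I a b → a ∈ C → b ∈ C)
    {f : minGens I →₀ MvPolynomial σ K} (hf : f ∈ relationModule I)
    (hlin : ∀ a, (f a).IsHomogeneous 1) :
    Finsupp.linearCombination (MvPolynomial σ K)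
      (fun a : minGens I => if a ∈ C then MvPolynomial.monomial a.1 (1 : K) else 0) f = 0 := by
  rw [relationModule, LinearMap.mem_ker, Finsupp.linearCombination_apply] at hf
  rw [Finsupp.linearCombination_apply]
  ext m
  have hm := congrArg (MvPolynomial.coeff m) hf
  rw [Finsupp.sum, MvPolynomial.coeff_sum, MvPolynomial.coeff_zero] at hm
  rw [Finsupp.sum, MvPolynomial.coeff_sum, MvPolynomial.coeff_zero]
  have key : ∀ a, MvPolynomial.coeff m (f a • MvPolynomial.monomial a.1 (1 : K)) ≠ 0 →
      ∃ i, m = Finsupp.single i 1 + a.1 := by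
    intro a ha
    rw [smul_eq_mul, MvPolynomial.coeff_mul_monomial'] at ha
    split_ifs at ha with hle
    · have h1 : (m - a.1).degree = 1 := by
        rw [Finsupp.degree_eq_weight_one]
        exact hlin a (left_ne_zero_of_mul ha)
      obtain ⟨i, hi⟩ := (Finsupp.sum_eq_one_iff _).1 h1
      exact ⟨i, by rw [← hi, tsub_add_cancel_of_le hle]⟩
    · exact absurd rfl ha
  by_cases h : ∃ a ∈ C, MvPolynomial.coeff m (f a • MvPolynomial.monomial a.1 (1 : K)) ≠ 0
  · obtain ⟨a, haC, ha⟩ := h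
    obtain ⟨i, hi⟩ := key a ha
    rw [← hm]
    refine Finset.sum_congr rfl fun b _ => ?_
    split_ifs with hb
    · rfl
    · by_contra hne
      have hne' : MvPolynomial.coeff m (f b • MvPolynomial.monomial b.1 (1 : K)) ≠ 0 := by
        intro h0
        rw [h0, smul_zero, MvPolynomial.coeff_zero] at hne
        exact hne rfl
      obtain ⟨j, hj⟩ := key b hne'
      exact hb (hC a b ⟨i, j, hi.symm.trans hj⟩ haC)
  · push Not at h
    refine Finset.sum_eq_zero fun b _ => ?_
    split_ifs with hb
    · exact h b hb
    · simp

theorem reflTransGen_linearlyLinked {K σ : Type*} [Field K] {I : Ideal (MvPolynomial σ K)}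
    (hlin : HasLinearRelations I) (a b : minGens I) :
    Relation.ReflTransGen (LinearlyLinked I) a b := by
  classical
  by_contra hab
  let C : Set (minGens I) := {c | Relation.ReflTransGen (LinearlyLinked I) a c}
  have hle : relationModule I ≤ LinearMap.ker (Finsupp.linearCombination (MvPolynomial σ K)
      (fun c : minGens I => if c ∈ C then MvPolynomial.monomial c.1 (1 : K) else 0)) := by
    rw [← hlin, Submodule.span_le]
    rintro f ⟨hf, hf1⟩
    exact linearCombination_indicator_eq_zero C (fun c d hcd hc => hc.tail hcd) hf hf1
  -- The trivial relation between `a` and `b`; truncated to the class of `a` it leaves a single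
  -- nonzero monomial.
  have hmem : Finsupp.single a (MvPolynomial.monomial b.1 (1 : K)) -
      Finsupp.single b (MvPolynomial.monomial a.1 (1 : K)) ∈ relationModule I := by
    rw [relationModule, LinearMap.mem_ker, map_sub, Finsupp.linearCombination_single,
      Finsupp.linearCombination_single, smul_eq_mul, smul_eq_mul, mul_comm, sub_self]
  have h := hle hmem
  have ha : a ∈ C := Relation.ReflTransGen.refl
  have hb : b ∉ C := hab
  rw [LinearMap.mem_ker, map_sub, Finsupp.linearCombination_single,
    Finsupp.linearCombination_single, if_pos ha, if_neg hb, smul_zero, sub_zero, smul_eq_mul,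
    MvPolynomial.monomial_mul, mul_one] at h
  exact one_ne_zero (MvPolynomial.monomial_eq_zero.1 h)

/-! ### Rank of the exponent vectors -/

/-- The exponent vector of `x^a t`. -/
noncomputable def reesExponent {σ : Type*} (a : σ →₀ ℕ) : Option σ →₀ ℕ := a.optionElim 1

theorem ratExponent_reesExponent_add {σ : Type*} {a b : σ →₀ ℕ} {i j : σ}
    (h : Finsupp.single i 1 + a = Finsupp.single j 1 + b) :
    ratExponent _ (reesExponent b) = ratExponent _ (reesExponent a) +
      Finsupp.lmapDomain ℚ ℚ some (Finsupp.single i 1 - Finsupp.single j 1) := by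
  classical
  ext o
  rw [Finsupp.add_apply, ratExponent_apply, ratExponent_apply]
  cases o with
  | none => rw [map_sub]; simp [reesExponent]
  | some k =>
    have hk := congrArg (fun x : ℕ => (x : ℚ)) (DFunLike.congr_fun h k)
    simp only [Finsupp.add_apply, Finsupp.single_apply, Nat.cast_add, Nat.cast_ite, Nat.cast_one,
      Nat.cast_zero] at hk
    simp only [reesExponent, Finsupp.optionElim_apply_some, Finsupp.lmapDomain_apply, map_sub,
      Finsupp.mapDomain_single, Finsupp.sub_apply, Finsupp.single_apply, Option.some.injEq]
    linear_combination (-1 : ℚ) * hk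

theorem span_reesExponent_eq_sup {K σ : Type*} [Field K] {I : Ideal (MvPolynomial σ K)}
    (hlin : HasLinearRelations I) (a₀ : minGens I) :
    Submodule.span ℚ (Set.range fun a : minGens I => ratExponent _ (reesExponent a.1)) =
      Submodule.span ℚ {ratExponent _ (reesExponent a₀.1)} ⊔
        (linearRelationGraphOnVars I).edgeSpan.map (Finsupp.lmapDomain ℚ ℚ some) := by
  refine le_antisymm ?_ (sup_le ?_ ?_)
  · rw [Submodule.span_le]
    rintro _ ⟨a, rfl⟩
    have h := reflTransGen_linearlyLinked hlin a₀ a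
    induction h with
    | refl => exact Submodule.mem_sup_left (Submodule.mem_span_singleton_self _)
    | @tail b c _ hbc ih =>
      obtain ⟨i, j, hij⟩ := hbc
      change ratExponent _ (reesExponent c.1) ∈ _
      rw [ratExponent_reesExponent_add hij]
      refine add_mem ih ?_
      by_cases hne : i = j
      · simp [hne]
      · exact Submodule.mem_sup_right (Submodule.mem_map_of_mem (Submodule.subset_span
          ⟨i, j, linearRelationGraphOnVars_adj_iff.2 ⟨hne, b.1, b.2, c.1, c.2, hij⟩, rfl⟩))
  · exact Submodule.span_mono (Set.singleton_subset_iff.2 ⟨a₀, rfl⟩)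
  · rw [SimpleGraph.edgeSpan, Submodule.map_span, Submodule.span_le]
    rintro _ ⟨_, ⟨i, j, hij, rfl⟩, rfl⟩
    obtain ⟨-, a, ha, b, hb, hab⟩ := linearRelationGraphOnVars_adj_iff.1 hij
    rw [SetLike.mem_coe, ← sub_eq_iff_eq_add'.2 (ratExponent_reesExponent_add hab)]
    exact sub_mem (Submodule.subset_span ⟨⟨b, hb⟩, rfl⟩) (Submodule.subset_span ⟨⟨a, ha⟩, rfl⟩)

theorem finrank_span_reesExponent {K σ : Type*} [Field K] [Finite σ]
    {I : Ideal (MvPolynomial σ K)} (hlin : HasLinearRelations I) (a₀ : minGens I) :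
    Module.finrank ℚ
      (Submodule.span ℚ (Set.range fun a : minGens I => ratExponent _ (reesExponent a.1))) =
      1 + Module.finrank ℚ (linearRelationGraphOnVars I).edgeSpan := by
  have hnone : ratExponent _ (reesExponent a₀.1) none = 1 := by
    simp [ratExponent_apply, reesExponent]
  -- The `t`-coordinate is 1 on the chosen generator and 0 on every edge vector, so the sum is
  -- direct.
  have hinf : Submodule.span ℚ {ratExponent _ (reesExponent a₀.1)} ⊓
      (linearRelationGraphOnVars I).edgeSpan.map (Finsupp.lmapDomain ℚ ℚ some) = ⊥ := by
    rw [eq_bot_iff]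
    rintro x ⟨hx, y, -, rfl⟩
    obtain ⟨c, hc⟩ := Submodule.mem_span_singleton.1 hx
    have h0 := DFunLike.congr_fun hc none
    rw [Finsupp.smul_apply, hnone, smul_eq_mul, mul_one, Finsupp.lmapDomain_apply,
      Finsupp.mapDomain_of_notMem_range _ _ (by simp)] at h0
    rw [← hc, h0, zero_smul]
    exact Submodule.zero_mem _
  have h := Submodule.finrank_sup_add_finrank_inf_eq
    (Submodule.span ℚ {ratExponent _ (reesExponent a₀.1)})
    ((linearRelationGraphOnVars I).edgeSpan.map (Finsupp.lmapDomain ℚ ℚ some))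
  rw [hinf, finrank_bot, add_zero, finrank_span_singleton (fun h => by simp [h] at hnone),
    ← LinearEquiv.finrank_eq (Submodule.equivMapOfInjective _
      (Finsupp.mapDomain_injective (Option.some_injective _)) _)] at h
  rw [span_reesExponent_eq_sup hlin a₀, h]

/-! ### The fiber ring as a monomial algebra -/

theorem IsMonomialIdeal.eq_span_minGens {K σ : Type*} [Field K] [Finite σ]
    {I : Ideal (MvPolynomial σ K)} (hI : IsMonomialIdeal I) :
    I = Ideal.span ((fun a => MvPolynomial.monomial a (1 : K)) '' minGens I) := by
  refine le_antisymm ?_ (Ideal.span_le.2 ?_)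
  · obtain ⟨A, hA⟩ := hI
    conv_lhs => rw [hA]
    refine Ideal.span_le.2 ?_
    rintro _ ⟨a, ha, rfl⟩
    have haI : MvPolynomial.monomial a (1 : K) ∈ I := hA ▸ Ideal.subset_span ⟨a, ha, rfl⟩
    obtain ⟨b, hba, hb⟩ := exists_minimal_le_of_wellFoundedLT
      (fun b => MvPolynomial.monomial b (1 : K) ∈ I) a haI
    have h : MvPolynomial.monomial a (1 : K) =
        MvPolynomial.monomial (a - b) 1 * MvPolynomial.monomial b 1 := by
      rw [MvPolynomial.monomial_mul, tsub_add_cancel_of_le hba, mul_one]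
    change MvPolynomial.monomial a (1 : K) ∈ _
    rw [h]
    exact Ideal.mul_mem_left _ _ (Ideal.subset_span ⟨b, hb, rfl⟩)
  · rintro _ ⟨a, ha, rfl⟩
    exact Minimal.prop (P := fun b => MvPolynomial.monomial b (1 : K) ∈ I) ha

theorem le_pow_gradedMaximalIdeal {K σ : Type*} [Field K] [Finite σ]
    {I : Ideal (MvPolynomial σ K)} (hI : IsMonomialIdeal I) {d : ℕ}
    (hd : ∀ a ∈ minGens I, a.degree = d) : I ≤ gradedMaximalIdeal K σ ^ d := by
  rw [hI.eq_span_minGens, Ideal.span_le]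
  rintro _ ⟨a, ha, rfl⟩
  exact (MvPolynomial.monomial_mem_pow_idealOfVars_iff d a one_ne_zero).2 (hd a ha).ge

theorem coeff_mem_pow_of_mem_map_gradedMaximalIdeal {K σ : Type*} [Field K]
    {I : Ideal (MvPolynomial σ K)} {d : ℕ} (hd : I ≤ gradedMaximalIdeal K σ ^ d)
    {z : reesAlgebra I}
    (hz : z ∈ (gradedMaximalIdeal K σ).map (algebraMap (MvPolynomial σ K) (reesAlgebra I)))
    (k : ℕ) : (z : Polynomial (MvPolynomial σ K)).coeff k ∈
      gradedMaximalIdeal K σ ^ (d * k + 1) := by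
  -- This is an ideal because the `t^k`-coefficient of a Rees element lies in `I^k ⊆ 𝔪^(dk)`.
  let J : Ideal (reesAlgebra I) :=
    { carrier := {z | ∀ k, (z : Polynomial (MvPolynomial σ K)).coeff k ∈
        gradedMaximalIdeal K σ ^ (d * k + 1)}
      add_mem' := fun {x y} hx hy k => by
        rw [Subalgebra.coe_add, Polynomial.coeff_add]
        exact add_mem (hx k) (hy k)
      zero_mem' := fun k => by simp
      smul_mem' := fun w z hz k => by
        rw [smul_eq_mul, Subalgebra.coe_mul, Polynomial.coeff_mul]
        refine sum_mem fun ij hij => ?_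
        rw [← Finset.HasAntidiagonal.mem_antidiagonal.1 hij, mul_add, add_assoc, pow_add, pow_mul]
        exact Ideal.mul_mem_mul (Ideal.pow_right_mono hd _ (w.2 _)) (hz _) }
  have hle : (gradedMaximalIdeal K σ).map (algebraMap (MvPolynomial σ K) (reesAlgebra I)) ≤ J := by
    rw [Ideal.map_le_iff_le_comap]
    intro s hs k
    change (Polynomial.C s).coeff k ∈ _
    rw [Polynomial.coeff_C]
    split_ifs with hk
    · simpa [hk] using hs
    · exact zero_mem _
  exact hle hz k

/-- The map from the polynomial ring on the minimal generators to the Rees algebra that sends the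
variable of a generator `u` to `u t`. -/
noncomputable def toRees {K σ : Type*} [Field K] (I : Ideal (MvPolynomial σ K)) :
    MvPolynomial (minGens I) K →ₐ[K] reesAlgebra I :=
  MvPolynomial.aeval fun a => ⟨Polynomial.monomial 1 (MvPolynomial.monomial a.1 (1 : K)),
    reesAlgebra.monomial_mem.2 (by
      rw [pow_one]
      exact Minimal.prop (P := fun b => MvPolynomial.monomial b (1 : K) ∈ I) a.2)⟩

/-- The map from the polynomial ring on the minimal generators onto the fiber ring. -/
noncomputable def toFiberRing {K σ : Type*} [Field K] (I : Ideal (MvPolynomial σ K)) :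
    MvPolynomial (minGens I) K →ₐ[K] FiberRing I :=
  (Ideal.Quotient.mkₐ K _).comp (toRees I)

theorem toFiberRing_surjective {K σ : Type*} [Field K] [Finite σ]
    {I : Ideal (MvPolynomial σ K)} (hI : IsMonomialIdeal I) :
    Function.Surjective (toFiberRing I) := by
  let q := Ideal.Quotient.mk
    ((gradedMaximalIdeal K σ).map (algebraMap (MvPolynomial σ K) (reesAlgebra I)))
  have hbase : ∀ s : MvPolynomial σ K,
      q (algebraMap _ _ s) ∈ (toFiberRing I).range := by
    intro s
    induction s using MvPolynomial.induction_on with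
    | C c => exact (toFiberRing I).range.algebraMap_mem c
    | add p r hp hr => rw [map_add, map_add]; exact add_mem hp hr
    | mul_X p i _ =>
      have : q (algebraMap _ _ (p * MvPolynomial.X i)) = 0 :=
        Ideal.Quotient.eq_zero_iff_mem.2 (Ideal.mem_map_of_mem _
          (Ideal.mul_mem_left _ _ (Ideal.subset_span ⟨i, rfl⟩)))
      rw [this]
      exact zero_mem _
  -- Modulo `𝔪` polynomials become constants, so the preimage of the image is an algebra over all of
  -- `K[σ]`; it then suffices that it contains `I t`.
  let T : Subalgebra (MvPolynomial σ K) (reesAlgebra I) :=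
    { (toFiberRing I).range.toSubsemiring.comap q with
      algebraMap_mem' := hbase }
  have hle : reesAlgebra I ≤ T.map (reesAlgebra I).val := by
    refine (adjoin_monomial_eq_reesAlgebra I).symm.le.trans ?_
    refine Algebra.adjoin_le ?_
    rintro _ ⟨f, hf, rfl⟩
    have hf' : f ∈ Ideal.span ((fun a => MvPolynomial.monomial a (1 : K)) '' minGens I) :=
      hI.eq_span_minGens ▸ hf
    induction hf' using Submodule.span_induction with
    | mem x hx =>
      obtain ⟨a, ha, rfl⟩ := hx
      refine ⟨toRees I (MvPolynomial.X ⟨a, ha⟩), ⟨MvPolynomial.X ⟨a, ha⟩, rfl⟩, ?_⟩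
      simp [toRees]
    | zero => rw [map_zero]; exact zero_mem _
    | add x y hx hy ihx ihy =>
      rw [map_add]
      exact add_mem (ihx (hI.eq_span_minGens ▸ hx)) (ihy (hI.eq_span_minGens ▸ hy))
    | smul s x hx ih =>
      rw [map_smul]
      exact Subalgebra.smul_mem _ (ih (hI.eq_span_minGens ▸ hx)) s
  intro z
  obtain ⟨z, rfl⟩ := Ideal.Quotient.mk_surjective z
  obtain ⟨w, hw, hwz⟩ := hle z.2
  obtain rfl : w = z := Subtype.ext hwz
  exact hw

theorem optionEquivLeft_aeval_reesExponent {K σ : Type*} [Field K] (I : Ideal (MvPolynomial σ K))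
    (p : MvPolynomial (minGens I) K) :
    MvPolynomial.optionEquivLeft K σ (MvPolynomial.aeval
      (fun a : minGens I => MvPolynomial.monomial (reesExponent a.1) (1 : K)) p) = toRees I p := by
  have h : ((MvPolynomial.optionEquivLeft K σ).toAlgHom.comp (MvPolynomial.aeval
      (fun a : minGens I => MvPolynomial.monomial (reesExponent a.1) (1 : K)))) =
      ((reesAlgebra I).val.restrictScalars K).comp (toRees I) := by
    refine MvPolynomial.algHom_ext fun a => ?_
    simp [toRees, MvPolynomial.optionEquivLeft_monomial, reesExponent]
  exact DFunLike.congr_fun h p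

theorem degree_some_linearCombination_reesExponent {ι σ : Type*} {v : ι → σ →₀ ℕ} {d : ℕ}
    (hd : ∀ i, (v i).degree = d) (f : ι →₀ ℕ) :
    (Finsupp.linearCombination ℕ (fun i => reesExponent (v i)) f).some.degree =
      d * Finsupp.linearCombination ℕ (fun i => reesExponent (v i)) f none := by
  induction f using Finsupp.induction_linear with
  | zero => simp
  | add f g hf hg => simp only [map_add, Finsupp.some_add, hf, hg, Finsupp.add_apply, mul_add]
  | single i n =>
    have h : (n • reesExponent (v i)).some = n • v i := by
      ext k
      simp [reesExponent, Finsupp.some_apply]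
    rw [Finsupp.linearCombination_single, h, map_nsmul, hd, Finsupp.smul_apply]
    simp [reesExponent, mul_comm]

theorem ker_toFiberRing {K σ : Type*} [Field K] [Finite σ]
    {I : Ideal (MvPolynomial σ K)} (hI : IsMonomialIdeal I) (hdeg : IsEquigenerated I) :
    RingHom.ker (toFiberRing I) = RingHom.ker (MvPolynomial.aeval (R := K)
      (fun a : minGens I => MvPolynomial.monomial (reesExponent a.1) (1 : K))) := by
  classical
  obtain ⟨d, hd⟩ := hdeg
  ext p
  rw [RingHom.mem_ker, RingHom.mem_ker]
  rw [← map_eq_zero_iff _ (MvPolynomial.optionEquivLeft K σ).injective,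
    optionEquivLeft_aeval_reesExponent]
  refine ⟨fun h => ?_, fun h => ?_⟩
  · have hmem : toRees I p ∈ _ := Ideal.Quotient.eq_zero_iff_mem.1 h
    ext k x
    rw [Polynomial.coeff_zero, MvPolynomial.coeff_zero]
    by_contra hne
    have h1 := (MvPolynomial.mem_pow_idealOfVars_iff (d * k + 1) _).1
      (coeff_mem_pow_of_mem_map_gradedMaximalIdeal (le_pow_gradedMaximalIdeal hI hd) hmem k) x
      (MvPolynomial.mem_support_iff.2 hne)
    rw [← optionEquivLeft_aeval_reesExponent, aeval_monomial_eq_sum, map_sum,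
      Polynomial.finsetSum_coeff, MvPolynomial.coeff_sum] at hne
    obtain ⟨s, -, hs⟩ := Finset.exists_ne_zero_of_sum_ne_zero hne
    rw [MvPolynomial.optionEquivLeft_monomial, Polynomial.coeff_monomial] at hs
    split_ifs at hs with hk
    · rw [MvPolynomial.coeff_monomial] at hs
      split_ifs at hs with hx
      -- The monomial `x` has degree exactly `dk`, against the lower bound `dk + 1` from `h1`.
      · have h2 := degree_some_linearCombination_reesExponent
          (v := fun a : minGens I => a.1) (fun a => hd a.1 a.2) s
        rw [hx, hk] at h2
        omega
      · exact hs rfl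
    · exact hs (MvPolynomial.coeff_zero _)
  · have h0 : toRees I p = 0 := Subtype.ext h
    rw [toFiberRing, AlgHom.comp_apply, h0, map_zero]

theorem analyticSpread_eq_finrank_span_reesExponent {K σ : Type*} [Field K] [Finite σ]
    {I : Ideal (MvPolynomial σ K)} (hI : IsMonomialIdeal I) (hdeg : IsEquigenerated I) :
    analyticSpread I = Module.finrank ℚ
      (Submodule.span ℚ (Set.range fun a : minGens I => ratExponent _ (reesExponent a.1))) := by
  have : Finite (minGens I) := by
    obtain ⟨d, hd⟩ := hdeg
    exact (Finsupp.finite_of_degree_eq d).subset hd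
  rw [← ringKrullDim_range_aeval_monomial K, analyticSpread,
    ← ringKrullDim_eq_of_ringEquiv
      (Ideal.quotientKerAlgEquivOfSurjective (toFiberRing_surjective hI)).toRingEquiv,
    ringKrullDim_eq_of_ringEquiv (Ideal.quotEquivOfEq (ker_toFiberRing hI hdeg))]
  exact ringKrullDim_eq_of_ringEquiv (Ideal.quotientKerEquivRange
    (MvPolynomial.aeval (R := K)
      fun a : minGens I => MvPolynomial.monomial (reesExponent a.1) (1 : K))).toRingEquiv

theorem mainTheorem2 {K : Type*} [Field K] {n : ℕ} (I : Ideal (MvPolynomial (Fin n) K))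
    (hI : IsMonomialIdeal I) (hI0 : I ≠ ⊥) (hdeg : IsEquigenerated I)
    (hlin : HasLinearRelations I) (r s : ℕ)
    (hr : Nat.card (linearRelationVertices I) = r)
    (hs : Nat.card (linearRelationGraph I).ConnectedComponent = s) :
    s ≤ r ∧ analyticSpread I = ((r - s + 1 : ℕ) : WithBot ℕ∞) := by
  have hne : (minGens I).Nonempty := by
    by_contra h
    rw [Set.not_nonempty_iff_eq_empty] at h
    apply hI0
    rw [hI.eq_span_minGens, h, Set.image_empty, Ideal.span_empty]
  obtain ⟨a₀, ha₀⟩ := hne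
  have hrank := (linearRelationGraph I).finrank_edgeSpan_add_card
  rw [hr, hs, linearRelationGraph, SimpleGraph.finrank_edgeSpan_induce_support] at hrank
  -- `hrank` reads (edge rank) + `s` = `r`, so the subtraction `r - s` is not truncated.
  refine ⟨by omega, ?_⟩
  rw [analyticSpread_eq_finrank_span_reesExponent hI hdeg,
    finrank_span_reesExponent hlin ⟨a₀, ha₀⟩]
  norm_cast
  omega
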